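/- Let $T$ be a complete first-order theory of abelian groups in the pure group language $\{+\}$. Suppose that $T$ has a model $H$ which is a pure-injective abelian group (that is, every system of linear equations with integer coefficients and constants from $H$, in any set of variables, that is finitely satisfiable in $H$ has a solution in $H$) and which is of the form $H \cong K \oplus C \oplus D$, where $K$ is a nonzero direct sum of copies of the additive groups $\widehat{\mathbb{Z}_{(p)}}$ of $p$-adic integers (the prime $p$ may vary with the summand), $C$ is a direct sum of finite cyclic groups, and $D$ is a divisible abelian group. Then $T$ does not have the Schröder–Bernstein property: there are two models of $T$, each elementarily embeddable in the other one, that are not isomorphic. -/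

import Mathlib

open scoped DirectSum FirstOrder

universe u v w

/-- The function symbols of the pure language of groups: a single binary symbol for addition. -/
inductive AddFunc : ℕ → Type
  | add : AddFunc 2

/-- The pure language of (abelian) groups, `{+}`. -/
def addLang : FirstOrder.Language.{0, 0} where
  Functions := AddFunc
  Relations := fun _ => Empty

/-- A type with an addition, regarded as a structure in the language `{+}`. -/
instance addStructure (G : Type u) [Add G] : addLang.Structure G where
  funMap
    | AddFunc.add, x => x 0 + x 1
  RelMap := fun r _ => Empty.elim r

/-- The Schröder–Bernstein property of a theory: any two models, each of which is elementarily
embeddable in the other one, are isomorphic. -/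
def HasSBProperty {L : FirstOrder.Language.{u, v}} (T : L.Theory) : Prop :=
  ∀ M N : FirstOrder.Language.Theory.ModelType.{u, v, w} T,
    Nonempty (M ↪ₑ[L] N) → Nonempty (N ↪ₑ[L] M) → Nonempty (M ≃[L] N)

/-- `v` solves the linear equation `∑ x, e.1 x • x = e.2` over `G` (integer coefficients, finitely
many variables, constant term in `G`). -/
def SolvesEquation {G : Type u} [AddCommGroup G] {X : Type v} (v : X → G)
    (e : (X →₀ ℤ) × G) : Prop :=
  (e.1.sum fun x k => k • v x) = e.2

/-- An abelian group is pure-injective (algebraically compact) if every system of equations over it,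
in any set of variables, which is finitely satisfiable in it has a solution in it. -/
def IsPureInjective (G : Type u) [AddCommGroup G] : Prop :=
  ∀ (X : Type u) (S : Set ((X →₀ ℤ) × G)),
    (∀ S₀ ⊆ S, S₀.Finite → ∃ v : X → G, ∀ e ∈ S₀, SolvesEquation v e) →
      ∃ v : X → G, ∀ e ∈ S, SolvesEquation v e

/-- Every element is divisible by every nonzero natural number. -/
def IsDivisibleGroup (D : Type u) [AddCommGroup D] : Prop :=
  ∀ n : ℕ, n ≠ 0 → ∀ d : D, ∃ y : D, n • y = d

/-! Split one summand off `K`, so that H ≅ ℤ_p × R. Back-and-forth shows that A × R → B × R is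
elementary whenever A ≤ B are pure subgroups of ℤ_p containing 1 (`inclusionElementary`), so every
such A × R is a model of T. Take a unit t of ℤ_p transcendental over ℚ, let B be the set of p-adic
integers in ℚ[t], and A those coming from polynomials without linear term. Then A ≤ B and t²B ≤ A,
so each of A × R and B × R embeds elementarily in the other. Homomorphisms from a pure unital
subgroup to ℤ_p are multiplications by constants, so an isomorphism B ≃ A would put t in A, against
transcendence (`isEmpty_polyValues_addEquiv`). As A and B are countable, R has no nonzero
homomorphism to them (`hom_complement_eq_zero`), so R cancels from A × R ≃ B × R. -/

open FirstOrder FirstOrder.Language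

/-! ### Additive groups as structures -/

section Structure

/-- Additive maps preserve the interpretation of the language of groups. -/
theorem addLang_funMap_comp {G : Type v} {G' : Type w} [Add G] [Add G'] (f : G → G')
    (hf : ∀ x y, f (x + y) = f x + f y) {n : ℕ} (g : addLang.Functions n) (x : Fin n → G) :
    f (Structure.funMap g x) = Structure.funMap g (f ∘ x) := by
  cases g
  exact hf _ _

/-- An additive equivalence is an isomorphism of structures. -/
def AddEquiv.toLangEquiv {G : Type v} {G' : Type w} [Add G] [Add G'] (f : G ≃+ G') :
    G ≃[addLang] G' where
  toEquiv := f.toEquiv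
  map_fun' g x := addLang_funMap_comp f f.map_add g x
  map_rel' r _ := Empty.elim r

/-- An isomorphism of structures is an additive equivalence. -/
def FirstOrder.Language.Equiv.toAddEquiv {G : Type v} {G' : Type w} [Add G] [Add G']
    (f : G ≃[addLang] G') : G ≃+ G' where
  toEquiv := f.toEquiv
  map_add' x y := f.map_fun' AddFunc.add ![x, y]

/-- Terms of the language of groups are linear combinations with natural coefficients. -/
theorem exists_realize_term_eq_sum {ι : Type} [Fintype ι] (t : addLang.Term ι) :
    ∃ c : ι → ℕ, ∀ (G : Type u) [AddCommGroup G] (x : ι → G),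
      t.realize x = ∑ i, c i • x i := by
  classical
  induction t with
  | var i =>
    refine ⟨Pi.single i 1, fun G _ x => ?_⟩
    simp [Pi.single_apply, ite_smul]
  | func f ts ih =>
    cases f
    obtain ⟨c₀, h₀⟩ := ih 0
    obtain ⟨c₁, h₁⟩ := ih 1
    refine ⟨c₀ + c₁, fun G _ x => ?_⟩
    simp only [Pi.add_apply, add_smul, Finset.sum_add_distrib, ← h₀, ← h₁]
    rfl

end Structure

/-! ### Back-and-forth between pure subgroups of ℤ_p -/

section PadicSubgroups

variable {p : ℕ} [Fact p.Prime]

/-- A pure subgroup of the `p`-adic integers that contains `1`. -/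
structure IsPureUnital (A : AddSubgroup ℤ_[p]) : Prop where
  one_mem : 1 ∈ A
  mem_of_mul_mem : ∀ {m : ℤ} {x : ℤ_[p]}, m ≠ 0 → (m : ℤ_[p]) * x ∈ A → x ∈ A

theorem isPureUnital_top : IsPureUnital (⊤ : AddSubgroup ℤ_[p]) :=
  ⟨trivial, fun _ _ => trivial⟩

theorem IsPureUnital.natCast_mem {A : AddSubgroup ℤ_[p]} (hA : IsPureUnital A) (n : ℕ) :
    (n : ℤ_[p]) ∈ A := by
  simpa using A.nsmul_mem hA.one_mem n

theorem PadicInt.exists_natCast_dvd_sub (x : ℤ_[p]) (n : ℕ) :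
    ∃ k : ℕ, (p : ℤ_[p]) ^ n ∣ x - k :=
  ⟨x.appr n, Ideal.mem_span_singleton.1 (PadicInt.appr_spec n x)⟩

/-- If v is the valuation of m, then v < p ^ v ≤ |m| ≤ n. -/
theorem PadicInt.intCast_dvd_prime_pow {m : ℤ} (hm : m ≠ 0) {n : ℕ} (hmn : |m| ≤ n) :
    (m : ℤ_[p]) ∣ (p : ℤ_[p]) ^ n := by
  have hm' : (m : ℤ_[p]) ≠ 0 := by exact_mod_cast hm
  have hspec := PadicInt.unitCoeff_spec hm'
  set v := (m : ℤ_[p]).valuation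
  have hdvd : (p : ℤ) ^ v ∣ m := by
    rw [← PadicInt.pow_p_dvd_int_iff]
    exact ⟨_, by rw [mul_comm]; exact hspec⟩
  have hle : (p : ℤ) ^ v ≤ n := (Int.le_of_dvd (abs_pos.2 hm) ((dvd_abs _ _).2 hdvd)).trans hmn
  have hlt : v < p ^ v := Nat.lt_pow_self (Fact.out : p.Prime).one_lt
  have hvn : v ≤ n := by
    have : p ^ v ≤ n := by exact_mod_cast hle
    omega
  rw [hspec]
  exact (Units.isUnit _).mul_left_dvd.2 (pow_dvd_pow _ hvn)

theorem PadicInt.eq_zero_of_forall_pow_dvd {x : ℤ_[p]} (h : ∀ n : ℕ, (p : ℤ_[p]) ^ n ∣ x) :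
    x = 0 := by
  by_contra hx
  exact absurd ((PadicInt.mem_span_pow_iff_le_valuation x hx (x.valuation + 1)).1
    (Ideal.mem_span_singleton.2 (h _))) (by omega)

/-- Tuples of `p`-adic integers that are congruent modulo `p ^ N` and satisfy the same homogeneous
linear equations with coefficients of absolute value at most `N`. -/
structure PadicClose (N : ℕ) {ι : Type} [Fintype ι] (x y : ι → ℤ_[p]) : Prop where
  dvd_sub : ∀ i, (p : ℤ_[p]) ^ N ∣ x i - y i
  sum_eq_zero_iff : ∀ c : ι → ℤ, (∀ i, |c i| ≤ N) → (∑ i, c i * x i = 0 ↔ ∑ i, c i * y i = 0)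

variable {ι : Type} [Fintype ι]

theorem PadicClose.of_eq (N : ℕ) {x y : ι → ℤ_[p]} (h : ∀ i, x i = y i) : PadicClose N x y :=
  ⟨fun i => by simp [h i], fun _ _ => by simp only [h]⟩

theorem PadicClose.symm {N : ℕ} {x y : ι → ℤ_[p]} (h : PadicClose N x y) : PadicClose N y x :=
  ⟨fun i => (dvd_sub_comm).1 (h.dvd_sub i), fun c hc => (h.sum_eq_zero_iff c hc).symm⟩

theorem PadicClose.mono {N N' : ℕ} (hN : N' ≤ N) {x y : ι → ℤ_[p]} (h : PadicClose N x y) :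
    PadicClose N' x y :=
  ⟨fun i => (pow_dvd_pow _ hN).trans (h.dvd_sub i),
    fun c hc => h.sum_eq_zero_iff c fun i => (hc i).trans (by exact_mod_cast hN)⟩

theorem IsPureUnital.infinite_dvd_sub {B : AddSubgroup ℤ_[p]} (hB : IsPureUnital B)
    (a : ℤ_[p]) (N : ℕ) : {b | b ∈ B ∧ (p : ℤ_[p]) ^ N ∣ a - b}.Infinite := by
  obtain ⟨k, hk⟩ := PadicInt.exists_natCast_dvd_sub a N
  have hp : p ≠ 0 := (Fact.out : p.Prime).ne_zero
  refine Set.infinite_of_injective_forall_mem (f := fun j : ℕ => ((k + p ^ N * j : ℕ) : ℤ_[p]))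
    (fun i j hij => ?_) fun j => ⟨hB.natCast_mem _, ?_⟩
  · have : k + p ^ N * i = k + p ^ N * j := Nat.cast_injective hij
    exact Nat.eq_of_mul_eq_mul_left (by positivity) (Nat.add_left_cancel this)
  · push_cast
    rw [← sub_sub]
    exact dvd_sub hk (dvd_mul_right _ _)

/-- Each of the finitely many pairs (c, m) determines b. These are the values to avoid when `a`
satisfies no small relation. -/
theorem finite_solutions (y : ι → ℤ_[p]) (N : ℕ) :
    {b : ℤ_[p] | ∃ (c : ι → ℤ) (m : ℤ), (∀ i, |c i| ≤ N) ∧ m ≠ 0 ∧ |m| ≤ N ∧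
      ∑ i, c i * y i + m * b = 0}.Finite := by
  classical
  have hfin : ((Set.Icc (fun _ : ι => -(N : ℤ)) fun _ => (N : ℤ)) ×ˢ
      Set.Icc (-(N : ℤ)) (N : ℤ)).Finite := (Set.finite_Icc _ _).prod (Set.finite_Icc _ _)
  refine (hfin.biUnion (t := fun cm => {b : ℤ_[p] | cm.2 ≠ 0 ∧
    ∑ i, (cm.1 i : ℤ_[p]) * y i + cm.2 * b = 0}) fun cm _ => ?_).subset ?_
  · refine Set.Subsingleton.finite fun b hb b' hb' => ?_
    have h : (cm.2 : ℤ_[p]) * b = cm.2 * b' := add_left_cancel (hb.2.trans hb'.2.symm)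
    exact mul_left_cancel₀ (by exact_mod_cast hb.1) h
  · rintro b ⟨c, m, hc, hm, hmN, h⟩
    simp only [Set.mem_iUnion]
    exact ⟨(c, m), ⟨⟨fun i => (abs_le.1 (hc i)).1, fun i => (abs_le.1 (hc i)).2⟩,
      abs_le.1 hmN⟩, hm, h⟩

/-- The extension step of the back-and-forth argument. -/
theorem PadicClose.exists_extension {B : AddSubgroup ℤ_[p]} (hB : IsPureUnital B) {N : ℕ}
    {x y : ι → ℤ_[p]} (h : PadicClose (2 * N ^ 2 + 2 * N) x y) (hy : ∀ i, y i ∈ B) (a : ℤ_[p]) :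
    ∃ b ∈ B, (p : ℤ_[p]) ^ N ∣ a - b ∧ ∀ (c : ι → ℤ) (m : ℤ), (∀ i, |c i| ≤ N) → |m| ≤ N →
      (∑ i, c i * x i + m * a = 0 ↔ ∑ i, c i * y i + m * b = 0) := by
  by_cases hrel : ∃ (c : ι → ℤ) (m : ℤ), (∀ i, |c i| ≤ N) ∧ m ≠ 0 ∧ |m| ≤ N ∧
      ∑ i, (c i : ℤ_[p]) * x i + m * a = 0
  · obtain ⟨c, m, hc, hm, hmN, hcm⟩ := hrel
    -- A small relation determines b from y. Dividing by m costs at most a factor p ^ N, which the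
    -- precision of x ≡ y absorbs.
    have hm' : (m : ℤ_[p]) ≠ 0 := by exact_mod_cast hm
    obtain ⟨k, hk⟩ := PadicInt.intCast_dvd_prime_pow (p := p) hm hmN
    obtain ⟨z, hz⟩ : (p : ℤ_[p]) ^ (2 * N ^ 2 + 2 * N) ∣
        ∑ i, (c i : ℤ_[p]) * x i - ∑ i, (c i : ℤ_[p]) * y i := by
      rw [← Finset.sum_sub_distrib]
      refine Finset.dvd_sum fun i _ => ?_
      rw [← mul_sub]
      exact (h.dvd_sub i).mul_left _
    rw [show 2 * N ^ 2 + 2 * N = N + (2 * N ^ 2 + N) by ring, pow_add] at hz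
    have hmb : ∑ i, (c i : ℤ_[p]) * y i + m * (a + (p : ℤ_[p]) ^ (2 * N ^ 2 + N) * (k * z)) = 0 := by
      linear_combination hcm - hz - (p : ℤ_[p]) ^ (2 * N ^ 2 + N) * z * hk
    refine ⟨a + (p : ℤ_[p]) ^ (2 * N ^ 2 + N) * (k * z), ?_, ?_, fun c' m' hc' hm'N => ?_⟩
    · refine hB.mem_of_mul_mem hm ?_
      rw [← neg_eq_of_add_eq_zero_right hmb]
      refine B.neg_mem (B.sum_mem fun i _ => ?_)
      rw [← zsmul_eq_mul]
      exact B.zsmul_mem (hy i) _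
    · rw [sub_add_cancel_left, dvd_neg]
      exact (pow_dvd_pow _ (by omega)).mul_right _
    -- Eliminating the last variable turns any other small relation into one among the old
    -- variables, with coefficients at most 2 * N ^ 2.
    · have key : ∀ (w : ι → ℤ_[p]) (b : ℤ_[p]), ∑ i, (c i : ℤ_[p]) * w i + m * b = 0 →
          (∑ i, (c' i : ℤ_[p]) * w i + m' * b = 0 ↔
            ∑ i, ((m * c' i - m' * c i : ℤ) : ℤ_[p]) * w i = 0) := by
        intro w b hb
        have : ∑ i, ((m * c' i - m' * c i : ℤ) : ℤ_[p]) * w i =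
            m * (∑ i, (c' i : ℤ_[p]) * w i + m' * b) := by
          have : ∑ i, ((m * c' i - m' * c i : ℤ) : ℤ_[p]) * w i =
              m * ∑ i, (c' i : ℤ_[p]) * w i - m' * ∑ i, (c i : ℤ_[p]) * w i := by
            rw [Finset.mul_sum, Finset.mul_sum, ← Finset.sum_sub_distrib]
            exact Finset.sum_congr rfl fun i _ => by push_cast; ring
          rw [this]
          linear_combination -(m' : ℤ_[p]) * hb
        rw [this, mul_eq_zero, or_iff_right hm']
      rw [key x a hcm, key y _ hmb]
      refine h.sum_eq_zero_iff _ fun i => ?_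
      have h1 : |m * c' i| ≤ (N : ℤ) * N := by
        rw [abs_mul]; exact mul_le_mul hmN (hc' i) (abs_nonneg _) (by positivity)
      have h2 : |m' * c i| ≤ (N : ℤ) * N := by
        rw [abs_mul]; exact mul_le_mul hm'N (hc i) (abs_nonneg _) (by positivity)
      have h3 := abs_sub (m * c' i) (m' * c i)
      push_cast
      nlinarith
  -- Here `a` is in no small relation, so b is chosen close to `a` outside the finite exceptional
  -- set.
  · obtain ⟨b, ⟨hbB, hab⟩, hb⟩ :=
      ((hB.infinite_dvd_sub a N).sdiff (finite_solutions y N)).nonempty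
    refine ⟨b, hbB, hab, fun c m hc hm => ?_⟩
    by_cases hm0 : m = 0
    · subst hm0
      simp only [Int.cast_zero, zero_mul, add_zero]
      refine h.sum_eq_zero_iff c fun i => (hc i).trans ?_
      push_cast
      nlinarith
    · exact iff_of_false (fun h0 => hrel ⟨c, m, hc, hm0, hm, h0⟩)
        fun h0 => hb ⟨c, m, hc, hm0, hm, h0⟩

end PadicSubgroups

/-! ### Elementarity of the inclusions -/

section Elementary

variable {p : ℕ} [Fact p.Prime] {R : Type u}

/-- Tuples in `A × R` and `B × R` with the same second coordinates and close first coordinates. -/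
structure ProdClose (N : ℕ) {A B : AddSubgroup ℤ_[p]} {ι : Type} [Fintype ι]
    (x : ι → A × R) (y : ι → B × R) : Prop where
  snd_eq : ∀ i, (x i).2 = (y i).2
  close : PadicClose N (fun i => ((x i).1 : ℤ_[p])) fun i => ((y i).1 : ℤ_[p])

theorem ProdClose.symm {N : ℕ} {A B : AddSubgroup ℤ_[p]} {ι : Type} [Fintype ι]
    {x : ι → A × R} {y : ι → B × R} (h : ProdClose N x y) : ProdClose N y x :=
  ⟨fun i => (h.snd_eq i).symm, h.close.symm⟩

theorem ProdClose.mono {N N' : ℕ} (hN : N' ≤ N) {A B : AddSubgroup ℤ_[p]} {ι : Type} [Fintype ι]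
    {x : ι → A × R} {y : ι → B × R} (h : ProdClose N x y) : ProdClose N' x y :=
  ⟨h.snd_eq, h.close.mono hN⟩

theorem ProdClose.exists_snoc {N : ℕ} {A B : AddSubgroup ℤ_[p]} (hB : IsPureUnital B)
    {α : Type} [Fintype α] {k : ℕ} {v : α → A × R} {xs : Fin k → A × R} {w : α → B × R}
    {ys : Fin k → B × R}
    (h : ProdClose (2 * N ^ 2 + 2 * N) (Sum.elim v xs) (Sum.elim w ys)) (a : A × R) :
    ∃ b : B × R, ProdClose N (Sum.elim v (Fin.snoc xs a : Fin (k + 1) → A × R))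
      (Sum.elim w (Fin.snoc ys b : Fin (k + 1) → B × R)) := by
  obtain ⟨b, hb, hab, hrel⟩ :=
    h.close.exists_extension hB (fun i => (Sum.elim w ys i).1.2) (a.1 : ℤ_[p])
  refine ⟨(⟨b, hb⟩, a.2), ?_, ?_, fun c hc => ?_⟩
  · rintro (i | i)
    · exact h.snd_eq (Sum.inl i)
    · refine Fin.lastCases ?_ (fun j => ?_) i
      · simp
      · simpa using h.snd_eq (Sum.inr j)
  · have hd := (h.mono (by nlinarith : N ≤ 2 * N ^ 2 + 2 * N)).close.dvd_sub
    rintro (i | i)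
    · exact hd (Sum.inl i)
    · refine Fin.lastCases ?_ (fun j => ?_) i
      · simpa using hab
      · simpa using hd (Sum.inr j)
  · have := hrel (Sum.elim (fun i => c (Sum.inl i)) fun j => c (Sum.inr j.castSucc))
      (c (Sum.inr (Fin.last k))) (by rintro (i | i) <;> exact hc _) (hc _)
    simpa [Fintype.sum_sum_type, Fin.sum_univ_castSucc, add_assoc] using this

theorem exists_forall_prodClose_realize_iff [AddCommGroup R] {α : Type} [Fintype α] {k : ℕ}
    (φ : addLang.BoundedFormula α k) :
    ∃ N : ℕ, ∀ (A B : AddSubgroup ℤ_[p]), IsPureUnital A → IsPureUnital B →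
      ∀ (v : α → A × R) (xs : Fin k → A × R) (w : α → B × R) (ys : Fin k → B × R),
        ProdClose N (Sum.elim v xs) (Sum.elim w ys) → (φ.Realize v xs ↔ φ.Realize w ys) := by
  induction φ with
  | falsum => exact ⟨0, fun _ _ _ _ _ _ _ _ _ => Iff.rfl⟩
  | @equal n t₁ t₂ =>
    obtain ⟨c₁, h₁⟩ := exists_realize_term_eq_sum.{u} t₁
    obtain ⟨c₂, h₂⟩ := exists_realize_term_eq_sum.{u} t₂
    -- This total bounds every |c₁ i - c₂ i|.
    refine ⟨∑ i, (c₁ i + c₂ i), fun A B hA hB v xs w ys h => ?_⟩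
    have key : ∀ (C : AddSubgroup ℤ_[p]) (z : α ⊕ Fin n → C × R), t₁.realize z = t₂.realize z ↔
        ∑ i, ((c₁ i - c₂ i : ℤ) : ℤ_[p]) * (z i).1 = 0 ∧
          ∑ i, c₁ i • (z i).2 = ∑ i, c₂ i • (z i).2 := by
      intro C z
      rw [h₁, h₂, Prod.ext_iff, Prod.fst_sum, Prod.fst_sum, Prod.snd_sum, Prod.snd_sum,
        ← Subtype.coe_inj]
      refine and_congr ?_ Iff.rfl
      simp [sub_mul, Finset.sum_sub_distrib, sub_eq_zero]
    refine (key A _).trans (Iff.trans ?_ (key B _).symm)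
    refine and_congr (h.close.sum_eq_zero_iff _ fun i => ?_) ?_
    · have := Finset.single_le_sum (f := fun i => c₁ i + c₂ i) (fun _ _ => Nat.zero_le _)
        (Finset.mem_univ i)
      rw [abs_le]
      omega
    · simp only [h.snd_eq]
  | rel r => exact Empty.elim r
  | imp φ ψ ihφ ihψ =>
    obtain ⟨N₁, h₁⟩ := ihφ
    obtain ⟨N₂, h₂⟩ := ihψ
    refine ⟨max N₁ N₂, fun A B hA hB v xs w ys h => ?_⟩
    exact imp_congr (h₁ A B hA hB v xs w ys (h.mono (le_max_left _ _)))
      (h₂ A B hA hB v xs w ys (h.mono (le_max_right _ _)))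
  | all φ ih =>
    obtain ⟨N, hN⟩ := ih
    have key : ∀ (A B : AddSubgroup ℤ_[p]), IsPureUnital A → IsPureUnital B →
        ∀ v xs w ys, ProdClose (R := R) (A := A) (B := B) (2 * N ^ 2 + 2 * N) (Sum.elim v xs)
          (Sum.elim w ys) → φ.all.Realize v xs → φ.all.Realize w ys := by
      intro A B hA hB v xs w ys h hφ b
      obtain ⟨a, hab⟩ := h.symm.exists_snoc hA b
      exact (hN A B hA hB _ _ _ _ hab.symm).1 (hφ a)
    exact ⟨_, fun A B hA hB v xs w ys h =>
      ⟨key A B hA hB _ _ _ _ h, key B A hB hA _ _ _ _ h.symm⟩⟩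

/-- The inclusion of pure unital subgroups of `ℤ_[p]`, times a fixed group, is elementary. -/
noncomputable def inclusionElementary (R : Type u) [AddCommGroup R] {A B : AddSubgroup ℤ_[p]}
    (hA : IsPureUnital A) (hB : IsPureUnital B) (hAB : A ≤ B) : (A × R) ↪ₑ[addLang] (B × R) where
  toFun := Prod.map (AddSubgroup.inclusion hAB) id
  map_formula' n φ x := by
    obtain ⟨N, hN⟩ := exists_forall_prodClose_realize_iff (p := p) (R := R) φ
    refine (hN A B hA hB x default _ default ⟨?_, ?_⟩).symm
    · rintro (i | i)
      · rfl
      · exact i.elim0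
    · refine PadicClose.of_eq N fun i => ?_
      rcases i with i | i
      · rfl
      · exact i.elim0

end Elementary

/-! ### Splitting and cancellation of summands -/

section Algebra

/-- A split surjection decomposes its domain. -/
def AddMonoidHom.splitEquiv {G : Type v} {Z : Type w} [AddCommGroup G] [AddCommGroup Z]
    (π : G →+ Z) (σ : Z →+ G) (h : ∀ z, π (σ z) = z) : G ≃+ Z × π.ker where
  toFun x := (π x, ⟨x - σ (π x), by simp [AddMonoidHom.mem_ker, h]⟩)
  invFun y := σ y.1 + y.2
  left_inv x := by simp
  right_inv y := by
    have hy : π y.2 = 0 := y.2.2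
    ext <;> simp [h, hy]
  map_add' x y := by
    ext
    · simp
    · simp only [map_add, Prod.snd_add, AddSubgroup.coe_add]
      abel

/-- The first components of an isomorphism `A × R ≃+ B × R` and of its inverse compose to the
identity of `A` if there are no nonzero homomorphisms `R →+ A`. -/
theorem AddEquiv.fst_symm_fst_apply {A : Type u} {B : Type v} {R : Type w} [AddCommGroup A]
    [AddCommGroup B] [AddCommGroup R] (e : A × R ≃+ B × R) (hA : ∀ f : R →+ A, f = 0) (a : A) :
    (e.symm ((e (a, 0)).1, 0)).1 = a := by
  have h1 : e.symm ((e (a, 0)).1, 0) + e.symm (0, (e (a, 0)).2) = (a, 0) := by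
    rw [← map_add, Prod.mk_add_mk, add_zero, zero_add, Prod.mk.eta, e.symm_apply_apply]
  have h2 : (e.symm (0, (e (a, 0)).2)).1 = 0 :=
    DFunLike.congr_fun (hA ((AddMonoidHom.fst A R).comp
      (e.symm.toAddMonoidHom.comp (AddMonoidHom.inr B R)))) _
  have h3 := congrArg Prod.fst h1
  rwa [Prod.fst_add, h2, add_zero] at h3

/-- A common summand without nonzero homomorphisms to the complements can be cancelled. -/
theorem nonempty_addEquiv_of_prod_addEquiv {A : Type u} {B : Type v} {R : Type w}
    [AddCommGroup A] [AddCommGroup B] [AddCommGroup R] (hA : ∀ f : R →+ A, f = 0) (hB : ∀ f : R →+ B, f = 0)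
    (e : A × R ≃+ B × R) : Nonempty (A ≃+ B) := by
  exact ⟨AddEquiv.ofBijective
    ((AddMonoidHom.fst B R).comp (e.toAddMonoidHom.comp (AddMonoidHom.inl A R)))
    ⟨fun a a' h => (e.fst_symm_fst_apply hA a).symm.trans ((congrArg (fun b => (e.symm (b, 0)).1) h).trans
      (e.fst_symm_fst_apply hA a')), fun b => ⟨(e.symm (b, 0)).1, by simpa using e.symm.fst_symm_fst_apply hB b⟩⟩⟩

end Algebra

/-! ### Homomorphisms into ℤ_p, and a transcendental unit -/

section Homs

variable {p : ℕ} [Fact p.Prime]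

theorem padicInt_hom_apply_eq_zero {G : Type*} [AddCommGroup G] (f : G →+ ℤ_[p]) {x : G}
    (hx : ∀ n : ℕ, ∃ y, p ^ n • y = x) : f x = 0 := by
  refine PadicInt.eq_zero_of_forall_pow_dvd fun n => ?_
  obtain ⟨y, rfl⟩ := hx n
  exact ⟨f y, by rw [map_nsmul, nsmul_eq_mul, Nat.cast_pow]⟩

/-- Write x = k + p ^ n * y with k natural; purity gives y ∈ A, so both sides agree modulo p ^ n for
every n. -/
theorem IsPureUnital.hom_apply {A : AddSubgroup ℤ_[p]} (hA : IsPureUnital A) (f : A →+ ℤ_[p])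
    (x : A) : f x = x * f ⟨1, hA.one_mem⟩ := by
  rw [← sub_eq_zero]
  refine PadicInt.eq_zero_of_forall_pow_dvd fun n => ?_
  obtain ⟨k, y, hy⟩ := PadicInt.exists_natCast_dvd_sub (x : ℤ_[p]) n
  have hp : (p : ℤ) ^ n ≠ 0 := pow_ne_zero _ (by exact_mod_cast (Fact.out : p.Prime).ne_zero)
  have hyA : y ∈ A := by
    refine hA.mem_of_mul_mem hp ?_
    push_cast
    rw [← hy]
    exact A.sub_mem x.2 (hA.natCast_mem k)
  have hx : x = k • (⟨1, hA.one_mem⟩ : A) + p ^ n • (⟨y, hyA⟩ : A) := by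
    ext
    simp only [AddSubgroup.coe_add, AddSubgroup.coe_nsmul, nsmul_eq_mul, mul_one, Nat.cast_pow]
    rw [← hy]
    ring
  have hf : f x = k * f ⟨1, hA.one_mem⟩ + (p : ℤ_[p]) ^ n * f ⟨y, hyA⟩ := by
    conv_lhs => rw [hx]
    rw [map_add, map_nsmul, map_nsmul, nsmul_eq_mul, nsmul_eq_mul, Nat.cast_pow]
  refine ⟨f ⟨y, hyA⟩ - y * f ⟨1, hA.one_mem⟩, ?_⟩
  linear_combination hf - f ⟨1, hA.one_mem⟩ * hy

instance PadicInt.uncountable : Uncountable ℤ_[p] := by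
  rw [← not_countable_iff]
  intro h
  have hs : Function.Surjective fun ab : ℤ_[p] × ℤ_[p] => (ab.1 : ℚ_[p]) / ab.2 := fun x => by
    obtain ⟨a, b, -, hab⟩ := IsFractionRing.div_surjective ℤ_[p] x
    exact ⟨(a, b), hab⟩
  have hc : Countable ℚ_[p] := hs.countable
  exact (Cardinal.aleph0_lt_continuum.trans_le
    (continuum_le_cardinal_of_nontriviallyNormedField ℚ_[p])).not_ge (Cardinal.mk_le_aleph0_iff.2 hc)

/-- For q = p, a nonzero f is an injective multiplication, impossible into a countable B. For q ≠ p,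
ℤ_q is p-divisible. -/
theorem hom_padicInt_eq_zero {q : ℕ} [Fact q.Prime] {B : AddSubgroup ℤ_[p]} (hB : Countable B)
    (f : ℤ_[q] →+ B) : f = 0 := by
  by_cases hqp : q = p
  · subst hqp
    set g : (⊤ : AddSubgroup ℤ_[q]) →+ ℤ_[q] :=
      B.subtype.comp (f.comp (AddSubgroup.subtype ⊤)) with hg
    have hmul : ∀ x, (f x : ℤ_[q]) = x * f 1 := fun x =>
      isPureUnital_top.hom_apply g ⟨x, trivial⟩
    have h0 : (f 1 : ℤ_[q]) = 0 := by
      by_contra h1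
      have hinj : Function.Injective f := fun x y hxy => by
        have := congrArg (Subtype.val) hxy
        rw [hmul, hmul y] at this
        exact mul_right_cancel₀ h1 this
      exact not_countable_iff.2 (PadicInt.uncountable (p := q)) hinj.countable
    ext x
    rw [hmul, h0, mul_zero]
    rfl
  · refine AddMonoidHom.ext fun x => Subtype.ext ?_
    refine padicInt_hom_apply_eq_zero (B.subtype.comp f) fun n => ?_
    have hu : IsUnit ((p ^ n : ℕ) : ℤ_[q]) := by
      rw [Nat.cast_pow]
      refine IsUnit.pow _ ?_
      rw [PadicInt.isUnit_iff, PadicInt.norm_natCast_eq_one_iff]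
      exact (Nat.coprime_primes Fact.out Fact.out).2 hqp
    obtain ⟨y, hy⟩ := hu.dvd (a := x)
    exact ⟨y, by rw [nsmul_eq_mul, hy]⟩

/-- The units 1 + p * z are uncountably many, the algebraic numbers countably many. -/
theorem exists_transcendental_unit : ∃ t : ℤ_[p]ˣ, Transcendental ℚ ((t : ℤ_[p]) : ℚ_[p]) := by
  by_contra! hcon
  have hunit : ∀ z : ℤ_[p], IsUnit (1 + p * z) := fun z => by
    have hz : ((p : ℤ_[p]) * z) ∈ IsLocalRing.maximalIdeal ℤ_[p] :=
      Ideal.mul_mem_right _ _ (by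
        rw [PadicInt.maximalIdeal_eq_span_p]; exact Ideal.mem_span_singleton_self _)
    by_contra h
    exact (Ideal.ne_top_iff_one _).1 (IsLocalRing.maximalIdeal.isMaximal ℤ_[p]).ne_top
      (by simpa using Ideal.sub_mem _ ((IsLocalRing.mem_maximalIdeal _).2 h) hz)
  have hp : (p : ℤ_[p]) ≠ 0 := by exact_mod_cast (Fact.out : p.Prime).ne_zero
  have hc := (Algebraic.countable ℚ ℚ_[p]).to_subtype
  have hinj : Function.Injective (fun z : ℤ_[p] =>
      (⟨((1 + p * z : ℤ_[p]) : ℚ_[p]), not_not.1 (hcon (hunit z).unit)⟩ :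
        {x : ℚ_[p] | IsAlgebraic ℚ x})) := fun z z' h => by
    have h1 := Subtype.coe_injective (Subtype.mk.inj h)
    exact mul_left_cancel₀ hp (add_left_cancel h1)
  exact not_countable_iff.2 (PadicInt.uncountable (p := p)) hinj.countable

end Homs

/-! ### The two subgroups of polynomial values -/

section PolynomialSubgroups

open Polynomial

variable {p : ℕ} [Fact p.Prime]

/-- The `p`-adic integers that are values at `t` of polynomials in `S`. -/
noncomputable def polyValues (t : ℤ_[p]) (S : Submodule ℚ ℚ[X]) : AddSubgroup ℤ_[p] :=
  (S.map (aeval (t : ℚ_[p])).toLinearMap).toAddSubgroup.comap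
    (PadicInt.Coe.ringHom : ℤ_[p] →+* ℚ_[p]).toAddMonoidHom

theorem mem_polyValues {t : ℤ_[p]} {S : Submodule ℚ ℚ[X]} {x : ℤ_[p]} :
    x ∈ polyValues t S ↔ ∃ f ∈ S, aeval (t : ℚ_[p]) f = (x : ℚ_[p]) :=
  Iff.rfl

theorem isPureUnital_polyValues (t : ℤ_[p]) {S : Submodule ℚ ℚ[X]} (hS : 1 ∈ S) :
    IsPureUnital (polyValues t S) where
  one_mem := mem_polyValues.2 ⟨1, hS, by simp⟩
  mem_of_mul_mem {m x} hm := by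
    rintro ⟨f, hf, hx⟩
    refine mem_polyValues.2 ⟨(m : ℚ)⁻¹ • f, S.smul_mem _ hf, ?_⟩
    have hm' : (m : ℚ_[p]) ≠ 0 := by exact_mod_cast hm
    have hx' : aeval (t : ℚ_[p]) f = m * x := by
      refine Eq.trans hx ?_
      change ((m * x : ℤ_[p]) : ℚ_[p]) = m * x
      simp
    rw [map_smul, hx', Algebra.smul_def]
    simp [hm']

theorem countable_polyValues (t : ℤ_[p]) (S : Submodule ℚ ℚ[X]) : Countable (polyValues t S) := by
  have : Countable ℚ[X] := Cardinal.mk_le_aleph0_iff.1 (by simp)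
  have h : (Set.range fun f : ℚ[X] => aeval (t : ℚ_[p]) f).Countable := Set.countable_range _
  refine ((h.preimage (f := fun x : ℤ_[p] => (x : ℚ_[p]))
    Subtype.coe_injective).mono ?_).to_subtype
  rintro x ⟨f, -, hx⟩
  exact ⟨f, hx⟩

/-- Polynomials without linear term. -/
noncomputable def noLinearTerm : Submodule ℚ ℚ[X] := LinearMap.ker (lcoeff ℚ 1)

theorem mem_noLinearTerm {f : ℚ[X]} : f ∈ noLinearTerm ↔ f.coeff 1 = 0 := Iff.rfl

theorem one_mem_noLinearTerm : (1 : ℚ[X]) ∈ noLinearTerm := by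
  simp [mem_noLinearTerm, coeff_one]

theorem polyValues_mono (t : ℤ_[p]) {S S' : Submodule ℚ ℚ[X]} (h : S ≤ S') :
    polyValues t S ≤ polyValues t S' := by
  rintro x ⟨f, hf, hx⟩
  exact ⟨f, h hf, hx⟩

theorem mul_mem_polyValues_top {t x : ℤ_[p]} (hx : x ∈ polyValues t ⊤) :
    t * x ∈ polyValues t ⊤ := by
  obtain ⟨f, -, hf⟩ := mem_polyValues.1 hx
  exact mem_polyValues.2 ⟨X * f, trivial, by simp [hf]⟩

theorem sq_mul_mem_polyValues {t x : ℤ_[p]} (hx : x ∈ polyValues t ⊤) :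
    t ^ 2 * x ∈ polyValues t noLinearTerm := by
  obtain ⟨f, -, hf⟩ := mem_polyValues.1 hx
  refine mem_polyValues.2 ⟨X ^ 2 * f, ?_, by simp [hf]⟩
  rw [mem_noLinearTerm, coeff_X_pow_mul']
  simp

theorem not_mem_polyValues_noLinearTerm {t : ℤ_[p]} (ht : Transcendental ℚ (t : ℚ_[p])) :
    t ∉ polyValues t noLinearTerm := by
  intro h
  obtain ⟨f, hf, hft⟩ := mem_polyValues.1 h
  have hX : f = X := transcendental_iff_injective.1 ht (by simp [hft])
  rw [mem_noLinearTerm, hX] at hf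
  simp at hf

theorem isEmpty_polyValues_addEquiv {t : ℤ_[p]} (ht : Transcendental ℚ (t : ℚ_[p])) :
    IsEmpty (polyValues t noLinearTerm ≃+ polyValues t ⊤) := by
  refine ⟨fun e => not_mem_polyValues_noLinearTerm ht ?_⟩
  have hA := isPureUnital_polyValues t one_mem_noLinearTerm
  have hB := isPureUnital_polyValues t (Submodule.mem_top (x := (1 : ℚ[X])))
  have hg := hB.hom_apply ((AddSubgroup.subtype _).comp e.symm.toAddMonoidHom)
  -- `e.symm` multiplies by a constant and sends y to 1, hence t * y to t.
  set y := e ⟨1, hA.one_mem⟩ with hy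
  have h1 := hg y
  have h2 := hg ⟨t * y, mul_mem_polyValues_top y.2⟩
  simp only [AddMonoidHom.comp_apply, AddEquiv.coe_toAddMonoidHom, AddSubgroup.subtype_apply] at h1 h2
  have h3 : ((e.symm y : polyValues t noLinearTerm) : ℤ_[p]) = 1 := by
    rw [hy, e.symm_apply_apply]
  rw [h3] at h1
  rw [mul_assoc, ← h1, mul_one] at h2
  exact (congrArg (· ∈ polyValues (t : ℤ_[p]) noLinearTerm) h2).mp (Subtype.property _)

/-- Multiplication by a unit, from the preimage of a subgroup. -/
noncomputable def unitMulEquiv (s : ℤ_[p]ˣ) (A : AddSubgroup ℤ_[p]) :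
    A.comap (AddMonoidHom.mulLeft (s : ℤ_[p])) ≃+ A where
  toFun x := ⟨s * x, x.2⟩
  invFun y := ⟨s⁻¹.1 * y, by simp [AddSubgroup.mem_comap]⟩
  left_inv x := by simp
  right_inv y := by simp
  map_add' x y := by ext; simp [mul_add]

end PolynomialSubgroups

theorem IsPureUnital.comap {p : ℕ} [Fact p.Prime] {A : AddSubgroup ℤ_[p]} (hA : IsPureUnital A)
    {s : ℤ_[p]} (hs : s ∈ A) : IsPureUnital (A.comap (AddMonoidHom.mulLeft s)) where
  one_mem := by simpa [AddSubgroup.mem_comap] using hs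
  mem_of_mul_mem {m x} hm h := by
    refine hA.mem_of_mul_mem hm ?_
    rw [AddSubgroup.mem_comap, AddMonoidHom.coe_mulLeft] at h
    rwa [AddMonoidHom.coe_mulLeft, mul_left_comm]

/-! ### No homomorphisms from the complement -/

section Complement

variable {I : Type u} {p : I → ℕ} [∀ i, Fact (p i).Prime] {J : Type u} {n : J → ℕ}
  {D : Type u} [AddCommGroup D]

theorem hom_complement_eq_zero (hn : ∀ j, n j ≠ 0) (hD : IsDivisibleGroup D) (i₀ : I)
    (π : (⨁ i : I, ℤ_[p i]) →+ ℤ_[p i₀]) (σ : ℤ_[p i₀] →+ ⨁ i : I, ℤ_[p i])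
    (hσ : ∀ z, π (σ z) = z) {B : AddSubgroup ℤ_[p i₀]} (hB : Countable B)
    (f : π.ker × (⨁ j : J, ZMod (n j)) × D →+ B) : f = 0 := by
  classical
  have hK : ∀ g : π.ker →+ B, g = 0 := fun g => by
    -- The retraction onto the kernel extends g to the whole direct sum, where vanishing is checked
    -- on each summand.
    set r : (⨁ i : I, ℤ_[p i]) →+ π.ker :=
      (AddMonoidHom.snd _ _).comp (π.splitEquiv σ hσ).toAddMonoidHom with hr
    have hgr : g.comp r = 0 := DirectSum.addHom_ext' fun i => by
      rw [hom_padicInt_eq_zero hB ((g.comp r).comp _), AddMonoidHom.zero_comp]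
    ext x
    have hrx : r x = x := Subtype.ext (by
      have hx : π x = 0 := x.2
      change (x : ⨁ i : I, ℤ_[p i]) - σ (π x) = x
      rw [hx, map_zero, sub_zero])
    have := DFunLike.congr_fun hgr (x : ⨁ i : I, ℤ_[p i])
    rw [AddMonoidHom.comp_apply, hrx] at this
    exact congrArg Subtype.val this
  have hC : ∀ g : (⨁ j : J, ZMod (n j)) →+ B, g = 0 := fun g => by
    refine DirectSum.addHom_ext' fun j => AddMonoidHom.ext fun z => ?_
    have h0 : n j • (g.comp (DirectSum.of (fun j => ZMod (n j)) j)) z = 0 := by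
      rw [← map_nsmul, nsmul_eq_mul, CharP.cast_eq_zero, zero_mul, map_zero]
    exact (smul_eq_zero.1 h0).resolve_left (hn j)
  have hD' : ∀ g : D →+ B, g = 0 := fun g => by
    refine AddMonoidHom.ext fun d => Subtype.ext ?_
    exact padicInt_hom_apply_eq_zero (B.subtype.comp g) fun k =>
      hD _ (pow_ne_zero _ (Fact.out : (p i₀).Prime).ne_zero) d
  refine AddMonoidHom.ext fun ⟨x, c, d⟩ => ?_
  have h : ((x, c, d) : π.ker × (⨁ j : J, ZMod (n j)) × D) =
      (x, 0, 0) + ((0, c, 0) + (0, 0, d)) := by simp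
  rw [h, map_add, map_add]
  have h1 : f (x, 0, 0) = 0 := DFunLike.congr_fun (hK (f.comp (AddMonoidHom.inl _ _))) x
  have h2 : f (0, c, 0) = 0 := DFunLike.congr_fun
    (hC (f.comp ((AddMonoidHom.inr _ _).comp (AddMonoidHom.inl _ _)))) c
  have h3 : f (0, 0, d) = 0 := DFunLike.congr_fun
    (hD' (f.comp ((AddMonoidHom.inr _ _).comp (AddMonoidHom.inr _ _)))) d
  simp [h1, h2, h3]

end Complement

/-- If every homomorphism from `R` to a countable subgroup of `ℤ_[p]` vanishes, then the theory of
`ℤ_[p] × R` does not have the Schröder–Bernstein property. -/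
theorem not_hasSBProperty_of_prod {p : ℕ} [Fact p.Prime] {R : Type u} [AddCommGroup R]
    (hR : ∀ B : AddSubgroup ℤ_[p], Countable B → ∀ f : R →+ B, f = 0) (T : addLang.Theory)
    (hT : (ℤ_[p] × R) ⊨ T) : ¬ HasSBProperty.{0, 0, u} T := by
  obtain ⟨t, ht⟩ := exists_transcendental_unit (p := p)
  set A := polyValues (t : ℤ_[p]) noLinearTerm
  set B := polyValues (t : ℤ_[p]) ⊤
  have hA : IsPureUnital A := isPureUnital_polyValues _ one_mem_noLinearTerm
  have hB : IsPureUnital B := isPureUnital_polyValues _ Submodule.mem_top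
  have hA' : IsPureUnital (A.comap (AddMonoidHom.mulLeft ((t ^ 2 : ℤ_[p]ˣ) : ℤ_[p]))) :=
    hA.comap (by simpa using sq_mul_mem_polyValues hB.one_mem)
  have hBA' : B ≤ A.comap (AddMonoidHom.mulLeft ((t ^ 2 : ℤ_[p]ˣ) : ℤ_[p])) := fun x hx => by
    simpa [AddSubgroup.mem_comap] using sq_mul_mem_polyValues hx
  have hmodel : ∀ {C : AddSubgroup ℤ_[p]}, IsPureUnital C → (C × R) ⊨ T := fun {C} hC => by
    have e : (ℤ_[p] × R) ≃[addLang] ((⊤ : AddSubgroup ℤ_[p]) × R) :=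
      (AddSubgroup.topEquiv.symm.prodCongr (AddEquiv.refl R)).toLangEquiv
    exact ((inclusionElementary R hC isPureUnital_top le_top).theory_model_iff T).2
      ((e.toElementaryEmbedding.theory_model_iff T).1 hT)
  intro hSB
  have hMA := hmodel hA
  have hMB := hmodel hB
  let M : FirstOrder.Language.Theory.ModelType.{0, 0, u} T := Theory.ModelType.of T (A × R)
  let N : FirstOrder.Language.Theory.ModelType.{0, 0, u} T := Theory.ModelType.of T (B × R)
  obtain ⟨e⟩ := hSB M N
    ⟨inclusionElementary R hA hB (polyValues_mono _ le_top)⟩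
    -- Multiplication by t²: the inclusion of B in t⁻²A, followed by t⁻²A ≃ A.
    ⟨((unitMulEquiv (t ^ 2) A).prodCongr (AddEquiv.refl R)).toLangEquiv.toElementaryEmbedding.comp
      (inclusionElementary R hB hA' hBA')⟩
  obtain ⟨e'⟩ := nonempty_addEquiv_of_prod_addEquiv (hR A (countable_polyValues _ _))
    (hR B (countable_polyValues _ _)) (FirstOrder.Language.Equiv.toAddEquiv (G := A × R) (G' := B × R) e)
  exact (isEmpty_polyValues_addEquiv ht).elim e'

theorem mainTheorem7 (T : addLang.Theory) (hT : T.IsComplete)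
    (H : Type u) [AddCommGroup H] (hHT : H ⊨ T) (hH : IsPureInjective H)
    (I : Type u) [Nonempty I] (p : I → ℕ) [∀ i, Fact (p i).Prime]
    (J : Type u) (n : J → ℕ) (hn : ∀ j, n j ≠ 0)
    (D : Type u) [AddCommGroup D] (hD : IsDivisibleGroup D)
    (e : H ≃+ (⨁ i : I, ℤ_[p i]) × (⨁ j : J, ZMod (n j)) × D) :
    ¬ HasSBProperty.{0, 0, u} T := by
  classical
  obtain ⟨i₀⟩ := ‹Nonempty I›
  let π : (⨁ i : I, ℤ_[p i]) →+ ℤ_[p i₀] := DFinsupp.evalAddMonoidHom i₀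
  let σ : ℤ_[p i₀] →+ ⨁ i : I, ℤ_[p i] := DirectSum.of (fun i => ℤ_[p i]) i₀
  have hσ : ∀ z, π (σ z) = z := fun z =>
    DirectSum.of_eq_same (β := fun i => ℤ_[p i]) i₀ z
  let e' : H ≃+ ℤ_[p i₀] × (π.ker × (⨁ j : J, ZMod (n j)) × D) :=
    (e.trans ((π.splitEquiv σ hσ).prodCongr (AddEquiv.refl _))).trans AddEquiv.prodAssoc
  exact not_hasSBProperty_of_prod
    (fun B hB f => hom_complement_eq_zero hn hD i₀ π σ hσ hB f) T
    ((e'.toLangEquiv.toElementaryEmbedding.theory_model_iff T).1 hHT)
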